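/- Let $F$ be an algebraically closed field of characteristic zero. A Lie triple system over $F$ is an $F$-vector space $T$ with a trilinear product $[x,y,z]$ such that, for all $a,b,x,y,z\in T$, $$[x,x,y]=0,\qquad [x,y,z]+[y,z,x]+[z,x,y]=0,$$ $$[a,b,[x,y,z]]=[[a,b,x],y,z]+[x,[a,b,y],z]+[x,y,[a,b,z]].$$ It is simple if its product is not identically zero and the only subspaces $I\subseteq T$ with $[I,T,T]\subseteq I$ are $0$ and $T$. Theorem. Let $T$ be a finite-dimensional simple Lie triple system over $F$. Then $\operatorname{End}_F(T)$, with the commutator bracket, is the Lie algebra generated by the maps $R_{a,b}\colon T\to T$, $c\mapsto [c,a,b]$ $(a,b\in T)$. -/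

import Mathlib

/-- A Lie triple system structure on the `F`-module `T`: a trilinear product `[x, y, z]` with
`[x, x, y] = 0`, the Jacobi identity, and such that every map `x ↦ [a, b, x]` is a derivation. -/
structure LieTripleSystem (F T : Type*) [CommRing F] [AddCommGroup T] [Module F T] where
  /-- The trilinear product; `product x y z` is `[x, y, z]`. -/
  product : T →ₗ[F] T →ₗ[F] T →ₗ[F] T
  product_self : ∀ x y : T, product x x y = 0
  jacobi : ∀ x y z : T, product x y z + product y z x + product z x y = 0
  derivation : ∀ a b x y z : T,
    product a b (product x y z) =
      product (product a b x) y z + product x (product a b y) z + product x y (product a b z)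

namespace LieTripleSystem

variable {F T : Type*} [CommRing F] [AddCommGroup T] [Module F T]

/-- An ideal is a submodule `I` with `[I, T, T] ⊆ I`; by skew-symmetry and the Jacobi identity,
also `[T, I, T] ⊆ I` and `[T, T, I] ⊆ I`. -/
def IsIdeal (S : LieTripleSystem F T) (I : Submodule F T) : Prop :=
  ∀ x ∈ I, ∀ a b : T, S.product x a b ∈ I

/-- A Lie triple system is simple if its product is not identically zero and its only ideals are
`0` and `T`. -/
def IsSimple (S : LieTripleSystem F T) : Prop :=
  (∃ a b c : T, S.product a b c ≠ 0) ∧ ∀ I : Submodule F T, S.IsIdeal I → I = ⊥ ∨ I = ⊤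

/-- The linear map `R a b : c ↦ [c, a, b]`. -/
def R (S : LieTripleSystem F T) (a b : T) : Module.End F T :=
  (S.product.flip a).flip b

theorem R_apply (S : LieTripleSystem F T) (a b c : T) : S.R a b c = S.product c a b := rfl

end LieTripleSystem

-- Endomorphism algebras carry the commutator bracket `⁅f, g⁆ = f * g - g * f`.
attribute [local instance 100] LieRing.ofAssociativeRing

/-! Let `M` be the Lie algebra generated by the `R a b`. The Killing form of the standard embedding,
restricted to `T`, is a nondegenerate symmetric form `B`, and `R a b` has adjoint `R b a`. So `M` is
stable under adjoints and splits into symmetric and skew parts; it acts irreducibly, because its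
stable subspaces are ideals. The key is a rank one element: for an extremal weight vector `v`, `R v
v` is a nonzero multiple of `B.outer v v` (`IsSimple.exists_R_self_eq`). Irreducibility is then
exploited by hand. There is an isotropic `u` with `B v u = 1` and `B.outer u u ∈ M`. Write `E_v`,
`E_u` for `symmPart B M v u`, `symmPart B M u v`; together they span the orthogonal complement of
`v, u` (`mem_symmPart_sup`), and a cubic relation (`cubic_mem`) gives a dichotomy. Either both equal
that complement, so that `M` contains all traceless maps, and also one of nonzero trace because `B`
is a sum of traces of the `R a b`; or both are nonzero and totally isotropic. In that case `T` is
the sum of two complementary subspaces preserved by inner derivations, and this forces the triple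
product to vanish. -/

namespace LieTripleSystem

/-! ### Inner derivations and the standard embedding. -/

section Basic

variable {F T : Type*} [CommRing F] [AddCommGroup T] [Module F T] (S : LieTripleSystem F T)

theorem product_skew (a b c : T) : S.product a b c = -S.product b a c := by
  have h := S.product_self (a + b) c
  simp only [map_add, LinearMap.add_apply, S.product_self, zero_add, add_zero] at h
  exact eq_neg_of_add_eq_zero_right h

theorem product_eq_sub (a b c : T) : S.product a b c = S.product c b a - S.product c a b := by
  have h := S.jacobi a b c
  rw [S.product_skew b c a] at h
  linear_combination (norm := abel) h

theorem product_eq_R_sub (a b : T) : S.product a b = S.R b a - S.R a b :=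
  LinearMap.ext fun c ↦ S.product_eq_sub a b c

/-- The span of the maps `c ↦ [a, b, c]`. -/
def innerSpan : Submodule F (Module.End F T) :=
  Submodule.span F {D | ∃ a b, D = S.product a b}

theorem product_mem_innerSpan (a b : T) : S.product a b ∈ S.innerSpan :=
  Submodule.subset_span ⟨a, b, rfl⟩

theorem apply_product_of_mem_innerSpan {D : Module.End F T} (hD : D ∈ S.innerSpan) (x y z : T) :
    D (S.product x y z) =
      S.product (D x) y z + S.product x (D y) z + S.product x y (D z) := by
  induction hD using Submodule.span_induction with
  | mem D h => obtain ⟨a, b, rfl⟩ := h; exact S.derivation a b x y z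
  | zero => simp
  | add D E _ _ h₁ h₂ => simp only [LinearMap.add_apply, h₁, h₂, map_add]; abel
  | smul r D _ h => simp only [LinearMap.smul_apply, h, map_smul, smul_add]

theorem lie_product_of_mem_innerSpan {D : Module.End F T} (hD : D ∈ S.innerSpan) (x y : T) :
    ⁅D, S.product x y⁆ = S.product (D x) y + S.product x (D y) := by
  ext z
  simp [LieRing.of_associative_ring_bracket, S.apply_product_of_mem_innerSpan hD]

/-- The Lie algebra of inner derivations, spanned by the maps `c ↦ [a, b, c]`. -/
def innerDer : LieSubalgebra F (Module.End F T) where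
  __ := S.innerSpan
  lie_mem' {D E} hD hE := by
    have hE' : E ∈ S.innerSpan := hE
    change ⁅D, E⁆ ∈ S.innerSpan
    induction hE' using Submodule.span_induction with
    | mem E h =>
      obtain ⟨a, b, rfl⟩ := h
      rw [S.lie_product_of_mem_innerSpan hD]
      exact add_mem (S.product_mem_innerSpan _ _) (S.product_mem_innerSpan _ _)
    | zero => simp
    | add E E' h h' h₁ h₂ => rw [lie_add]; exact add_mem (h₁ h) (h₂ h')
    | smul r E h h₁ => rw [lie_smul]; exact Submodule.smul_mem _ _ (h₁ h)

/-- The bilinear map sending `a, b` to the inner derivation `c ↦ [a, b, c]`. -/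
def inner : T →ₗ[F] T →ₗ[F] S.innerDer :=
  LinearMap.mk₂ F (fun a b ↦ ⟨S.product a b, S.product_mem_innerSpan a b⟩)
    (fun _ _ _ ↦ by ext; simp) (fun _ _ _ ↦ by ext; simp) (fun _ _ _ ↦ by ext; simp)
    (fun _ _ _ ↦ by ext; simp)

@[simp] theorem inner_apply (a b c : T) : (S.inner a b).1 c = S.product a b c := rfl

theorem inner_self (a : T) : S.inner a a = 0 :=
  Subtype.ext <| LinearMap.ext fun c ↦ S.product_self a c

theorem inner_skew (a b : T) : S.inner a b = -S.inner b a :=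
  Subtype.ext <| LinearMap.ext fun c ↦ S.product_skew a b c

theorem lie_inner (D : S.innerDer) (a b : T) :
    ⁅D, S.inner a b⁆ = S.inner (D.1 a) b + S.inner a (D.1 b) :=
  Subtype.ext <| S.lie_product_of_mem_innerSpan D.2 a b

theorem span_inner : Submodule.span F {D | ∃ a b, D = S.inner a b} = ⊤ := by
  rw [eq_top_iff]
  rintro ⟨D, hD⟩ -
  have hD' : D ∈ S.innerSpan := hD
  induction hD' using Submodule.span_induction with
  | mem D h => obtain ⟨a, b, rfl⟩ := h; exact Submodule.subset_span ⟨a, b, rfl⟩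
  | zero => exact zero_mem _
  | add D E h₁ h₂ h h' => exact add_mem (h h₁) (h' h₂)
  | smul r D h h' => exact Submodule.smul_mem _ r (h' h)

/-- The standard embedding Lie algebra of a Lie triple system: the direct sum of the triple system
and its inner derivations. -/
@[ext] structure StandardEmbedding where
  /-- The component in the triple system. -/
  fst : T
  /-- The component in the inner derivations. -/
  snd : S.innerDer

namespace StandardEmbedding

/-- The standard embedding as a product type. -/
def toProd : S.StandardEmbedding ≃ T × S.innerDer where
  toFun x := (x.fst, x.snd)
  invFun x := ⟨x.1, x.2⟩
  left_inv _ := rfl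
  right_inv _ := rfl

instance : AddCommGroup S.StandardEmbedding := (toProd S).addCommGroup
instance : Module F S.StandardEmbedding := (toProd S).module F

/-- The standard embedding as a product of modules. -/
def toProdₗ : S.StandardEmbedding ≃ₗ[F] T × S.innerDer where
  __ := toProd S
  map_add' _ _ := rfl
  map_smul' _ _ := rfl

variable {S}

instance : Bracket S.StandardEmbedding S.StandardEmbedding where
  bracket x y := ⟨x.snd.1 y.fst - y.snd.1 x.fst, S.inner x.fst y.fst + ⁅x.snd, y.snd⁆⟩

@[simp] theorem lie_fst (x y : S.StandardEmbedding) :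
    ⁅x, y⁆.fst = x.snd.1 y.fst - y.snd.1 x.fst := rfl
@[simp] theorem lie_snd (x y : S.StandardEmbedding) :
    ⁅x, y⁆.snd = S.inner x.fst y.fst + ⁅x.snd, y.snd⁆ := rfl
@[simp] theorem add_fst (x y : S.StandardEmbedding) : (x + y).fst = x.fst + y.fst := rfl
@[simp] theorem add_snd (x y : S.StandardEmbedding) : (x + y).snd = x.snd + y.snd := rfl
@[simp] theorem zero_fst : (0 : S.StandardEmbedding).fst = 0 := rfl
@[simp] theorem zero_snd : (0 : S.StandardEmbedding).snd = 0 := rfl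
@[simp] theorem neg_fst (x : S.StandardEmbedding) : (-x).fst = -x.fst := rfl
@[simp] theorem neg_snd (x : S.StandardEmbedding) : (-x).snd = -x.snd := rfl
@[simp] theorem smul_fst (r : F) (x : S.StandardEmbedding) : (r • x).fst = r • x.fst := rfl
@[simp] theorem smul_snd (r : F) (x : S.StandardEmbedding) : (r • x).snd = r • x.snd := rfl

instance : LieRing S.StandardEmbedding where
  add_lie x y z := by ext1 <;> simp <;> abel
  lie_add x y z := by ext1 <;> simp <;> abel
  lie_self x := by ext1 <;> simp [inner_self]
  leibniz_lie x y z := by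
    ext1
    · simp only [lie_fst, lie_snd, add_fst, map_sub, LinearMap.add_apply, AddMemClass.coe_add,
        LieSubalgebra.coe_bracket, LieRing.of_associative_ring_bracket, LinearMap.sub_apply,
        Module.End.mul_apply, inner_apply]
      -- The Jacobi identity of the triple product is the bracket identity for three elements of
      -- `T`.
      rw [S.product_eq_sub y.fst z.fst x.fst]
      abel
    · simp only [lie_fst, lie_snd, add_snd, map_sub, lie_add, add_lie, lie_inner,
        LinearMap.sub_apply]
      rw [leibniz_lie x.snd y.snd z.snd, ← lie_skew (S.inner x.fst y.fst) z.snd, lie_inner]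
      simp only [S.inner_skew y.fst (z.snd.1 x.fst)]
      abel

instance : LieAlgebra F S.StandardEmbedding where
  lie_smul r x y := by ext1 <;> simp [smul_sub]

variable (S)

/-- The inclusion of a Lie triple system into its standard embedding. -/
def inl : T →ₗ[F] S.StandardEmbedding :=
  (toProdₗ S).symm.toLinearMap ∘ₗ LinearMap.inl F T S.innerDer

/-- The inclusion of the inner derivations into the standard embedding. -/
def inr : S.innerDer →ₗ[F] S.StandardEmbedding :=
  (toProdₗ S).symm.toLinearMap ∘ₗ LinearMap.inr F T S.innerDer

@[simp] theorem inl_fst (a : T) : (inl S a).fst = a := rfl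
@[simp] theorem inl_snd (a : T) : (inl S a).snd = 0 := rfl
@[simp] theorem inr_fst (D : S.innerDer) : (inr S D).fst = 0 := rfl
@[simp] theorem inr_snd (D : S.innerDer) : (inr S D).snd = D := rfl

theorem eq_inl_add_inr (x : S.StandardEmbedding) : x = inl S x.fst + inr S x.snd := by ext1 <;> simp

theorem lie_inl_inl (a b : T) : ⁅inl S a, inl S b⁆ = inr S (S.inner a b) := by ext1 <;> simp
theorem lie_inr_inl (D : S.innerDer) (a : T) : ⁅inr S D, inl S a⁆ = inl S (D.1 a) := by
  ext1 <;> simp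
theorem lie_inl_inr (a : T) (D : S.innerDer) : ⁅inl S a, inr S D⁆ = -inl S (D.1 a) := by
  rw [← lie_skew, lie_inr_inl]
end StandardEmbedding

end Basic

end LieTripleSystem

namespace LieTripleSystem

open StandardEmbedding

/-! ### The Killing form of the standard embedding, restricted to the triple system. -/

section KillingForm

variable {F T : Type*} [Field F] [AddCommGroup T] [Module F T]
  (S : LieTripleSystem F T)

instance [FiniteDimensional F T] : FiniteDimensional F S.StandardEmbedding :=
  Module.Finite.equiv (toProdₗ S).symm

/-- The involution of the standard embedding acting as `-1` on the triple system. -/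
def StandardEmbedding.involution : S.StandardEmbedding ≃ₗ⁅F⁆ S.StandardEmbedding where
  toFun x := ⟨-x.fst, x.snd⟩
  invFun x := ⟨-x.fst, x.snd⟩
  map_add' x y := by ext1 <;> simp [add_comm]
  map_smul' r x := by ext1 <;> simp
  map_lie' {x y} := by
    ext1 <;> simp
    abel
  left_inv x := by simp
  right_inv x := by simp

@[simp] theorem StandardEmbedding.involution_apply (x : S.StandardEmbedding) :
    involution S x = ⟨-x.fst, x.snd⟩ := rfl

/-- The restriction of the Killing form of the standard embedding to the triple system. -/
noncomputable def form : LinearMap.BilinForm F T :=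
  (killingForm F S.StandardEmbedding).compl₁₂ (inl S) (inl S)

theorem form_apply (a b : T) :
    S.form a b = killingForm F S.StandardEmbedding (inl S a) (inl S b) := rfl

theorem form_comm (a b : T) : S.form a b = S.form b a :=
  LieModule.traceForm_comm F S.StandardEmbedding S.StandardEmbedding _ _

theorem form_R (a b c d : T) : S.form (S.R a b c) d = S.form c (S.R b a d) := by
  have h (x y z : T) : inl S (S.R y z x) = ⁅⁅inl S x, inl S y⁆, inl S z⁆ := by
    rw [lie_inl_inl, lie_inr_inl]; rfl
  rw [form_apply, form_apply, h, h, LieModule.traceForm_apply_lie_apply,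
    LieModule.traceForm_apply_lie_apply, ← lie_skew (inl S d) (inl S b), neg_lie, lie_skew]

theorem form_innerDer (D : S.innerDer) (a b : T) :
    S.form (D.1 a) b = -S.form a (D.1 b) := by
  rw [form_apply, form_apply, ← lie_inr_inl, ← lie_inr_inl, ← lie_skew, map_neg,
    LinearMap.neg_apply, LieModule.traceForm_apply_lie_apply]

/-- The product of `ad a` and `ad b` is block diagonal on `T ⊕ innerDer`. Its block on `innerDer`
factors through `T`, and swapping the two factors turns its trace into that of `R a b`. -/
theorem form_eq_trace [FiniteDimensional F T] (a b : T) :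
    S.form a b = LinearMap.trace F T (S.R b a) + LinearMap.trace F T (S.R a b) := by
  let P : T →ₗ[F] S.innerDer := S.inner a
  let Q : S.innerDer →ₗ[F] T := LinearMap.applyₗ b ∘ₗ S.innerDer.toSubmodule.subtype
  have h : (toProdₗ S).conj (LieAlgebra.ad F S.StandardEmbedding (inl S a) ∘ₗ
      LieAlgebra.ad F S.StandardEmbedding (inl S b)) =
      LinearMap.prodMap (S.R b a) (-(P ∘ₗ Q)) := by
    refine LinearMap.ext fun ⟨c, D⟩ ↦ Prod.ext ?_ ?_
    · change (⁅inl S a, ⁅inl S b, (⟨c, D⟩ : S.StandardEmbedding)⁆⁆).fst = S.product c b a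
      simp [S.product_skew c b]
    · change (⁅inl S a, ⁅inl S b, (⟨c, D⟩ : S.StandardEmbedding)⁆⁆).snd = -S.inner a (D.1 b)
      simp
  rw [form_apply, killingForm_apply_apply, ← LinearMap.trace_conj' _ (toProdₗ S), h,
    LinearMap.trace_prodMap', ← LinearMap.neg_comp, LinearMap.trace_comp_comm']
  congr 2
  ext c
  change -(S.inner a c).1 b = S.product c a b
  simp [S.product_skew c a]

/-- The two summands are eigenspaces of an automorphism for the eigenvalues `-1` and `1`. -/
theorem killingForm_inl_inr [CharZero F] (a : T) (D : S.innerDer) :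
    killingForm F S.StandardEmbedding (inl S a) (inr S D) = 0 := by
  have h := LieAlgebra.killingForm_of_equiv_apply (R := F) (involution S) (inl S a) (inr S D)
  have h₁ : involution S (inl S a) = -inl S a := by ext1 <;> simp
  have h₂ : involution S (inr S D) = inr S D := by ext1 <;> simp
  rw [h₁, h₂, map_neg, LinearMap.neg_apply] at h
  exact self_eq_neg.mp h.symm

variable {S}

theorem IsSimple.span_product (hS : S.IsSimple) :
    Submodule.span F {x | ∃ a b c, x = S.product a b c} = ⊤ := by
  have hI : S.IsIdeal (Submodule.span F {x | ∃ a b c, x = S.product a b c}) :=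
    fun x _ a b ↦ Submodule.subset_span ⟨x, a, b, rfl⟩
  refine (hS.2 _ hI).resolve_left fun h ↦ ?_
  obtain ⟨a, b, c, habc⟩ := hS.1
  have hmem : S.product a b c ∈ Submodule.span F {x | ∃ a b c, x = S.product a b c} :=
    Submodule.subset_span ⟨a, b, c, rfl⟩
  exact habc <| (Submodule.mem_bot F).mp <| h ▸ hmem

theorem IsSimple.derivedSeries_eq_top (hS : S.IsSimple) :
    LieAlgebra.derivedSeries F S.StandardEmbedding 1 = ⊤ := by
  set I := LieAlgebra.derivedSeries F S.StandardEmbedding 1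
  have hI (x y : S.StandardEmbedding) : ⁅x, y⁆ ∈ I := by
    simp only [I, LieAlgebra.derivedSeriesOfIdeal_succ, LieAlgebra.derivedSeriesOfIdeal_zero]
    exact LieSubmodule.lie_mem_lie (LieSubmodule.mem_top x) (LieSubmodule.mem_top y)
  have h₁ : (⊤ : Submodule F T) ≤ I.toSubmodule.comap (inl S) := by
    rw [← hS.span_product, Submodule.span_le]
    rintro _ ⟨a, b, c, rfl⟩
    change inl S ((S.inner a b).1 c) ∈ I
    rw [← lie_inr_inl]
    exact hI _ _
  have h₂ : (⊤ : Submodule F S.innerDer) ≤ I.toSubmodule.comap (inr S) := by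
    rw [← S.span_inner, Submodule.span_le]
    rintro _ ⟨a, b, rfl⟩
    change inr S (S.inner a b) ∈ I
    rw [← lie_inl_inl]
    exact hI _ _
  rw [eq_top_iff]
  intro x _
  rw [eq_inl_add_inr S x]
  exact add_mem (h₁ (Submodule.mem_top (x := x.fst))) (h₂ (Submodule.mem_top (x := x.snd)))

variable [FiniteDimensional F T] [CharZero F]

/-- Since `innerDer` is spanned by brackets of elements of `T`, invariance would make the whole
Killing form vanish. By Cartan's criterion the embedding would be solvable, but it is perfect. -/
theorem IsSimple.form_ne_zero (hS : S.IsSimple) : S.form ≠ 0 := by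
  intro h
  have h₁ (a b : T) : killingForm F S.StandardEmbedding (inl S a) (inl S b) = 0 :=
    LinearMap.congr_fun₂ h a b
  have h₂ (D E : S.innerDer) : killingForm F S.StandardEmbedding (inr S D) (inr S E) = 0 := by
    have hD : D ∈ Submodule.span F {D | ∃ a b, D = S.inner a b} := by simp [S.span_inner]
    induction hD using Submodule.span_induction with
    | mem D hD =>
      obtain ⟨a, b, rfl⟩ := hD
      rw [← lie_inl_inl, LieModule.traceForm_apply_lie_apply, lie_inl_inr, map_neg, h₁, neg_zero]
    | zero => simp
    | add D D' _ _ h h' => simp [h, h']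
    | smul r D _ h => simp [h]
  have h₃ (x y : S.StandardEmbedding) : killingForm F S.StandardEmbedding x y = 0 := by
    rw [eq_inl_add_inr S x, eq_inl_add_inr S y]
    simp only [map_add, LinearMap.add_apply, h₁, h₂, killingForm_inl_inr]
    rw [LieModule.traceForm_comm, killingForm_inl_inr]
    simp
  have := LieAlgebra.isSolvable_of_killingForm_apply_lie_eq_zero (R := F)
    (L := S.StandardEmbedding) fun x y _ ↦ h₃ x y
  obtain ⟨a, b, c, habc⟩ := hS.1
  have : Nontrivial S.StandardEmbedding := ⟨inl S (S.product a b c), 0, fun h ↦ habc <| by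
    simpa using congrArg StandardEmbedding.fst h⟩
  exact (LieAlgebra.derivedSeries_lt_top_of_solvable F S.StandardEmbedding).ne
    hS.derivedSeries_eq_top

theorem IsSimple.form_nondegenerate (hS : S.IsSimple) (a : T)
    (ha : ∀ b, S.form a b = 0) : a = 0 := by
  have h : S.IsIdeal (LinearMap.ker S.form) := fun x hx a b ↦ by
    ext c
    change S.form (S.R a b x) c = 0
    rw [S.form_R, LinearMap.mem_ker.mp hx, LinearMap.zero_apply]
  have h₁ : LinearMap.ker S.form = ⊥ :=
    (hS.2 _ h).resolve_right fun h ↦ hS.form_ne_zero (LinearMap.ker_eq_top.mp h)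
  exact (Submodule.mem_bot F).mp (h₁ ▸ LinearMap.mem_ker.mpr (LinearMap.ext ha))

end KillingForm

end LieTripleSystem

/-! ### A vector `v` for which `R v v` has rank one. -/

theorem Module.End.trace_mul_eq_zero_of_lie_lie_eq_zero {K V : Type*} [Field K] [IsAlgClosed K]
    [CharZero K] [AddCommGroup V] [Module K V] [FiniteDimensional K V] {X Y : Module.End K V}
    (hX : X ^ 3 = 0) (hXY : ⁅X, ⁅X, Y⁆⁆ = 0) : LinearMap.trace K V (X * Y) = 0 := by
  suffices h : ∀ r, (X * Y).HasEigenvalue r → r = 0 by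
    rw [Module.End.trace_eq_sum_roots_charpoly_of_splits (IsAlgClosed.splits _)]
    exact Multiset.sum_eq_zero fun r hr ↦ h r <|
      (Module.End.hasEigenvalue_iff_isRoot_charpoly _ r).mpr (Polynomial.isRoot_of_mem_roots hr)
  intro r hr
  by_contra hr₀
  obtain ⟨u, hu⟩ := hr.exists_hasEigenvector
  have hu' : X (Y u) = r • u := hu.apply_eq_smul
  have hX' (z : V) : X (X (X z)) = 0 := by simpa [pow_succ] using LinearMap.congr_fun hX z
  have hXY' (z : V) : X (X (Y z)) = (2 : K) • X (Y (X z)) - Y (X (X z)) := by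
    have := LinearMap.congr_fun hXY z
    simp only [LieRing.of_associative_ring_bracket, LinearMap.sub_apply, Module.End.mul_apply,
      map_sub, LinearMap.zero_apply] at this
    linear_combination (norm := module) this
  have h₁ (z : V) : X (X (Y (X z))) = 0 := by
    have e₁ := congrArg X (hXY' z)
    have e₂ := hXY' (X z)
    simp only [hX', map_sub, map_smul, map_zero, sub_zero] at e₁ e₂
    have e₃ : (3 : K) • X (X (Y (X z))) = 0 := by
      linear_combination (norm := module) (-1 : K) • e₂ + (-2 : K) • e₁
    exact (smul_eq_zero.mp e₃).resolve_left (by norm_num)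
  have h₂ : X u = 0 := by
    have e := h₁ (Y u)
    simp only [hu', map_smul] at e
    simpa [hr₀] using e
  set A : V → V := fun z ↦ X (Y z) - Y (X z) with hA
  have hxy (z : V) : X (Y z) = Y (X z) + A z := by simp [hA]
  have hxa (z : V) : X (A z) = A (X z) := by
    simp only [hA, map_sub]; linear_combination (norm := module) hXY' z
  have hadd (y z : V) : A (y + z) = A y + A z := by simp only [hA, map_add]; abel
  have hsmul (s : K) (z : V) : A (s • z) = s • A z := by simp only [hA, map_smul, smul_sub]
  have hAu : A u = r • u := by simp [hA, h₂, hu']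
  have e := hX' (Y (Y (Y u)))
  -- As `X u = 0`, the left side is `(ad X)^3 (Y^3)` applied to `u`. The derivation `ad X` sends `Y`
  -- to `A` and kills `A`, so this is `6 A^3 u`.
  have e' : X (X (X (Y (Y (Y u))))) = (6 * r ^ 3) • u := by
    simp only [hxy, h₂, hxa, hadd, hsmul, hAu, map_add, map_smul, map_zero, zero_add]
    module
  rw [e'] at e
  simp [hr₀, hu.2] at e

theorem LieModule.map_mem_genWeightSpace_add {R L M N : Type*} [CommRing R] [LieRing L]
    [LieAlgebra R L] [LieRing.IsNilpotent L] [AddCommGroup M] [Module R M] [LieRingModule L M]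
    [LieModule R L M] [AddCommGroup N] [Module R N] [LieRingModule L N] [LieModule R L N]
    (φ : M →ₗ[R] N) (χ ψ : L → R) (hφ : ∀ (x : L) (m : M), ⁅x, φ m⁆ = φ ⁅x, m⁆ + ψ x • φ m)
    {m : M} (hm : m ∈ genWeightSpace M χ) : φ m ∈ genWeightSpace N (χ + ψ) := by
  rw [mem_genWeightSpace] at hm ⊢
  intro x
  obtain ⟨k, hk⟩ := hm x
  have h : (toEnd R L N x - (χ + ψ) x • 1) ∘ₗ φ = φ ∘ₗ (toEnd R L M x - χ x • 1) := by
    ext m; simp [hφ, add_smul]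
  exact ⟨k, by simpa [hk] using LinearMap.congr_fun (Module.End.commute_pow_left_of_commute h k) m⟩

namespace LieTripleSystem

open StandardEmbedding LieModule

variable {F T : Type*} [Field F] [IsAlgClosed F] [CharZero F] [AddCommGroup T] [Module F T]
  [FiniteDimensional F T] {S : LieTripleSystem F T}

/-- The hypothesis gives `(ad v)^3 = 0` and `[v, [v, w]] = 0` in the embedding, so the trace lemma
puts `v` in the radical of the form. -/
theorem IsSimple.eq_zero_of_R_self_eq_zero (hS : S.IsSimple) {v : T} (hv : S.R v v = 0) :
    v = 0 := by
  have hv' (c : T) : S.product v c v = 0 := by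
    rw [S.product_skew, ← S.R_apply, hv, LinearMap.zero_apply, neg_zero]
  refine hS.form_nondegenerate v fun w ↦ ?_
  rw [form_apply, killingForm_apply_apply]
  refine Module.End.trace_mul_eq_zero_of_lie_lie_eq_zero ?_ ?_
  · ext1 x
    change ⁅inl S v, ⁅inl S v, ⁅inl S v, x⁆⁆⁆ = 0
    ext1 <;> simp [hv']
  · rw [← LieHom.map_lie, ← LieHom.map_lie, lie_inl_inl, lie_inl_inr]
    simp [hv']

theorem IsSimple.exists_R_self_eq (hS : S.IsSimple) :
    ∃ (v : T) (k : F), v ≠ 0 ∧ k ≠ 0 ∧ ∀ c, S.R v v c = (k * S.form v c) • v := by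
  suffices ∃ v : T, v ≠ 0 ∧ ∀ c, S.R v v c ∈ Submodule.span F {v} by
    obtain ⟨v, hv, h⟩ := this
    simp only [Submodule.mem_span_singleton] at h
    choose φ hφ using h
    obtain ⟨d, hd⟩ : ∃ d, S.form v d ≠ 0 := by
      by_contra! H; exact hv (hS.form_nondegenerate v H)
    -- Self-adjointness of `R v v` makes `φ` proportional to `S.form v`.
    have key (c : T) : S.R v v c = (φ d / S.form v d * S.form v c) • v := by
      have e := S.form_R v v c d
      rw [← hφ, ← hφ, map_smul, map_smul, LinearMap.smul_apply, S.form_comm c v,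
        smul_eq_mul, smul_eq_mul] at e
      rw [← hφ]
      congr 1
      field_simp
      linear_combination e
    refine ⟨v, φ d / S.form v d, hv, fun h ↦ hv (hS.eq_zero_of_R_self_eq_zero ?_), key⟩
    ext c
    rw [key, h, zero_mul, zero_smul, LinearMap.zero_apply]
  obtain ⟨x, hx⟩ := LieAlgebra.exists_isCartanSubalgebra_engel F S.innerDer
  set H := LieSubalgebra.engel F x
  have lie_def (D : H) (c : T) : ⁅D, c⁆ = D.1.1 c := rfl
  -- A rational functional detecting all nonzero sums of two weights replaces an ordering of the
  -- weights; `Λ` is extremal for it.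
  obtain ⟨f, hf⟩ := Module.exists_dual_forall_apply_ne_zero (K := ℚ)
    (fun p : {p : Weight F H T × Weight F H T // (p.1 + p.2 : H → F) ≠ 0} ↦
      (p.1.1 + p.1.2 : H → F)) (fun p ↦ p.2)
  have : Nontrivial T := by
    obtain ⟨a, b, c, h⟩ := hS.1
    exact ⟨_, _, h⟩
  have : Nonempty (Weight F H T) := by
    by_contra! contra
    simpa only [iSup_of_empty, bot_ne_top] using LieModule.iSup_genWeightSpace_eq_top' F H T
  obtain ⟨Λ, hΛ⟩ := Finite.exists_max fun χ : Weight F H T ↦ |f χ|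
  obtain ⟨v, hv, hΛv⟩ := exists_forall_lie_eq_smul F H T Λ
  refine ⟨v, hv, ?_⟩
  have htop : (⊤ : Submodule F T) ≤ (Submodule.span F {v}).comap (S.R v v) := by
    rw [← LieSubmodule.top_toSubmodule (R := F) (L := H), ← iSup_genWeightSpace_eq_top' F H T,
      LieSubmodule.iSup_toSubmodule, iSup_le_iff]
    intro χ c hc
    rw [Submodule.mem_comap]
    by_cases h₀ : S.R v v c = 0
    · rw [h₀]; exact zero_mem _
    have h₁ : S.R v v c ∈ genWeightSpace T (χ + (Λ + Λ) : H → F) := by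
      refine map_mem_genWeightSpace_add _ _ _ (fun D m ↦ ?_) hc
      have := hΛv D
      simp only [lie_def, R_apply] at this ⊢
      rw [S.apply_product_of_mem_innerSpan D.1.2, this]
      simp [add_smul, add_assoc]
    have h₂ : genWeightSpace T (χ + (Λ + Λ) : H → F) ≠ ⊥ := fun h ↦ h₀ <| by
      rwa [h, LieSubmodule.mem_bot] at h₁
    have h₃ : |f χ + (f Λ + f Λ)| ≤ |f Λ| := by
      simpa using hΛ ⟨_, h₂⟩
    -- Both `f χ` and `f χ + 2 f Λ` are bounded by `|f Λ|`, which forces `f χ = -f Λ`.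
    have h₄ : (χ + Λ : H → F) = 0 := by
      by_contra h
      refine hf ⟨(χ, Λ), h⟩ ?_
      have := hΛ χ
      simp only [map_add]
      rcases abs_cases (f χ) with h | h <;> rcases abs_cases (f Λ) with h' | h' <;>
        rcases abs_cases (f χ + (f Λ + f Λ)) with h'' | h'' <;> linarith
    have h₅ : S.inner c v ∈ genWeightSpace S.innerDer (χ + Λ : H → F) := by
      refine map_mem_genWeightSpace_add (S.inner.flip v) _ _ (fun D m ↦ ?_) hc
      have := hΛv D
      simp only [lie_def] at this
      change ⁅D.1, S.inner m v⁆ = S.inner (D.1.1 m) v + _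
      rw [lie_inner, this]
      simp
    -- A vector of weight zero lies in the Cartan subalgebra, which acts on `v` by scalars.
    have h₆ : S.inner c v ∈ H := by
      rw [h₄] at h₅
      have h := LieAlgebra.rootSpace_zero_eq F S.innerDer H
      exact (SetLike.ext_iff.mp h _).mp h₅
    have h₇ := hΛv ⟨S.inner c v, h₆⟩
    rw [Submodule.mem_span_singleton]
    exact ⟨_, h₇.symm⟩
  exact fun c ↦ htop Submodule.mem_top

end LieTripleSystem

/-! ### Rank one operators attached to a hyperbolic pair. -/

namespace LinearMap.BilinForm

variable {F V : Type*} [Field F] [AddCommGroup V] [Module F V]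

/-- The rank one endomorphism `c ↦ B b c • a`. -/
def outer (B : LinearMap.BilinForm F V) (a b : V) : Module.End F V := (B b).smulRight a

@[simp] theorem outer_apply (B : LinearMap.BilinForm F V) (a b c : V) :
    B.outer a b c = B b c • a := rfl

/-- A hyperbolic pair `v, u` for a symmetric bilinear form `B`, such that the endomorphisms
`B.outer v v` and `B.outer u u` belong to the Lie algebra `M`. -/
structure IsOuterPair (B : LinearMap.BilinForm F V) (M : LieSubalgebra F (Module.End F V))
    (v u : V) : Prop where
  symm : ∀ a b, B a b = B b a
  vv : B v v = 0
  uu : B u u = 0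
  vu : B v u = 1
  mem_v : B.outer v v ∈ M
  mem_u : B.outer u u ∈ M

namespace IsOuterPair

variable {B : LinearMap.BilinForm F V} {M : LieSubalgebra F (Module.End F V)} {v u : V}

theorem swap (h : IsOuterPair B M v u) : IsOuterPair B M u v :=
  ⟨h.symm, h.uu, h.vv, by rw [h.symm, h.vu], h.mem_u, h.mem_v⟩

theorem uv (h : IsOuterPair B M v u) : B u v = 1 := h.swap.vu

variable (B v u) in
/-- The orthogonal projection away from a hyperbolic plane. -/
def proj : Module.End F V := 1 - B.outer v u - B.outer u v

theorem proj_apply (c : V) : proj B v u c = c - B u c • v - B v c • u := rfl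

theorem proj_swap : proj B u v = proj B v u := sub_right_comm _ _ _

theorem eq_proj_add (v u c : V) : c = proj B v u c + B u c • v + B v c • u := by
  rw [proj_apply]; abel

theorem left_proj (h : IsOuterPair B M v u) (c : V) : B v (proj B v u c) = 0 := by
  simp [proj_apply, h.vv, h.vu]

theorem right_proj (h : IsOuterPair B M v u) (c : V) : B u (proj B v u c) = 0 := by
  simp [proj_apply, h.uu, h.uv]

theorem proj_left (h : IsOuterPair B M v u) : proj B v u v = 0 := by
  simp [proj_apply, h.vv, h.uv]

theorem proj_right (h : IsOuterPair B M v u) : proj B v u u = 0 := by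
  simp [proj_apply, h.uu, h.vu]

theorem proj_eq_self {c : V} (h₁ : B v c = 0) (h₂ : B u c = 0) : proj B v u c = c := by
  simp [proj_apply, h₁, h₂]

theorem apply_proj (c : V) {d : V} (h₁ : B v d = 0) (h₂ : B u d = 0) :
    B (proj B v u c) d = B c d := by
  simp [proj_apply, h₁, h₂]

variable (B M v u) in
/-- The vectors `a` orthogonal to `v` and `u` for which the symmetrisation of `B.outer v a`
belongs to `M`. -/
def symmPart : Submodule F V where
  carrier := {a | B v a = 0 ∧ B u a = 0 ∧ B.outer v a + B.outer a v ∈ M}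
  add_mem' {a b} ha hb := by
    refine ⟨by simp [ha.1, hb.1], by simp [ha.2.1, hb.2.1], ?_⟩
    convert! add_mem ha.2.2 hb.2.2 using 1
    ext c; simp; module
  zero_mem' := by
    refine ⟨by simp, by simp, ?_⟩
    convert! zero_mem M using 1
    ext c; simp
  smul_mem' r a ha := by
    refine ⟨by simp [ha.1], by simp [ha.2.1], ?_⟩
    convert! M.smul_mem r ha.2.2 using 1
    ext c; simp; module

theorem lie_apply (X Y : Module.End F V) (c : V) : ⁅X, Y⁆ c = X (Y c) - Y (X c) := rfl

/-- `B.outer v v` and `B.outer u u` generate an `sl₂`, under which `B.outer v a + B.outer a v` and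
`B.outer u a - B.outer a u` span a module. This lemma and the next pass between the two vectors. -/
theorem outer_sub_mem_of_mem_symmPart (h : IsOuterPair B M v u) {a : V}
    (ha : a ∈ symmPart B M v u) : B.outer u a - B.outer a u ∈ M := by
  obtain ⟨h₁, h₂, h₃⟩ := ha
  convert! M.lie_mem h.mem_u h₃ using 1
  ext c
  simp [h₂, h.symm a u, h.vu, h.uv, sub_eq_add_neg]

theorem mem_symmPart_of_outer_sub_mem (h : IsOuterPair B M v u) {a : V} (h₁ : B v a = 0)
    (h₂ : B u a = 0) (ha : B.outer u a - B.outer a u ∈ M) : a ∈ symmPart B M v u := by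
  refine ⟨h₁, h₂, ?_⟩
  convert! M.lie_mem h.mem_v ha using 1
  ext c
  simp [h₁, h.symm a v, h.vu, h.uv]

theorem outer_sub_outer_mem (h : IsOuterPair B M v u) : B.outer v u - B.outer u v ∈ M := by
  convert! M.lie_mem h.mem_v h.mem_u using 1
  ext c
  simp [h.vu, h.uv]

theorem proj_skew_mem (h : IsOuterPair B M v u) {Q : Module.End F V} (hQ : Q ∈ M)
    (hQ' : ∀ c d, B (Q c) d = -B c (Q d)) (h2 : (2 : F) ≠ 0) :
    proj B v u (Q v) ∈ symmPart B M v u := by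
  have h₀ : B v (Q v) = 0 := by
    have := hQ' v v
    rw [h.symm] at this
    have h3 : (2 : F) * B v (Q v) = 0 := by linear_combination this
    exact (mul_eq_zero.mp h3).resolve_left h2
  refine ⟨h.left_proj _, h.right_proj _, ?_⟩
  convert! sub_mem (neg_mem (M.lie_mem h.mem_v hQ)) (M.smul_mem (2 * B u (Q v)) h.mem_v) using 1
  ext c
  have := hQ' v c
  simp only [lie_apply, proj_apply, outer_apply, LinearMap.add_apply, LinearMap.sub_apply,
    LinearMap.neg_apply, LinearMap.smul_apply, map_smul, map_sub, smul_eq_mul, h₀, this]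
  module

theorem proj_symm_mem (h : IsOuterPair B M v u) {P : Module.End F V} (hP : P ∈ M)
    (hP' : ∀ c d, B (P c) d = B c (P d)) : proj B v u (P u) ∈ symmPart B M v u := by
  refine h.mem_symmPart_of_outer_sub_mem (h.left_proj _) (h.right_proj _) ?_
  convert! add_mem (M.lie_mem h.mem_u hP) (M.smul_mem (B u (P u)) h.outer_sub_outer_mem) using 1
  ext c
  have := hP' u c
  simp only [lie_apply, proj_apply, outer_apply, LinearMap.add_apply, LinearMap.sub_apply,
    LinearMap.smul_apply, map_smul, map_sub, smul_eq_mul, this]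
  module

/-- The bracket of `Q` with `B.outer v a + B.outer a v` is symmetric, so `proj_symm_mem` applies to
its value at `u`. With a symmetric `P` the bracket is skew, whence the passage to the other
`symmPart` in `proj_symm_mem_of_mem`. -/
theorem proj_skew_mem_of_mem (h : IsOuterPair B M v u) {Q : Module.End F V} (hQ : Q ∈ M)
    (hQ' : ∀ c d, B (Q c) d = -B c (Q d)) {a : V} (ha : a ∈ symmPart B M v u) :
    proj B v u (Q a) ∈ symmPart B M v u := by
  have h₁ := h.proj_symm_mem (M.lie_mem hQ ha.2.2) fun c d ↦ by
    simp only [lie_apply, outer_apply, LinearMap.add_apply, map_sub, map_add, map_smul,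
      LinearMap.sub_apply, LinearMap.smul_apply, smul_eq_mul, hQ']
    rw [h.symm a (Q c), h.symm v (Q c), h.symm c a, h.symm c v, hQ', hQ', h.symm c (Q v),
      h.symm c (Q a), hQ', hQ']
    ring
  convert add_mem h₁ (Submodule.smul_mem _ (B v (Q u)) ha) using 1
  simp only [lie_apply, outer_apply, LinearMap.add_apply, map_sub, map_add, map_smul, h.vu,
    h.symm a u, ha.2.1, h.proj_left, proj_eq_self ha.1 ha.2.1]
  module

theorem proj_symm_mem_of_mem (h : IsOuterPair B M v u) {P : Module.End F V} (hP : P ∈ M)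
    (hP' : ∀ c d, B (P c) d = B c (P d)) (h2 : (2 : F) ≠ 0) {a : V}
    (ha : a ∈ symmPart B M v u) :
    proj B v u (P a) - B v (P u) • a ∈ symmPart B M u v := by
  have h₁ := h.swap.proj_skew_mem (M.lie_mem hP ha.2.2) (fun c d ↦ by
    simp only [lie_apply, outer_apply, LinearMap.add_apply, map_sub, map_add, map_smul,
      LinearMap.sub_apply, LinearMap.smul_apply, smul_eq_mul, hP']
    rw [h.symm a (P c), h.symm v (P c), h.symm c a, h.symm c v, hP', hP', h.symm c (P v),
      h.symm c (P a), hP', hP']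
    ring) h2
  convert h₁ using 1
  simp only [proj_swap, lie_apply, outer_apply, LinearMap.add_apply, map_sub, map_add, map_smul,
    h.vu, h.symm a u, ha.2.1, h.proj_left, proj_eq_self ha.1 ha.2.1]
  module

/-- Bracketing the two operators attached to `t` gives a symmetric element of `M`, which is then
applied to `p`. -/
theorem cubic_mem (h : IsOuterPair B M v u) (h2 : (2 : F) ≠ 0) {t p : V}
    (ht : t ∈ symmPart B M v u) (hp : p ∈ symmPart B M v u) :
    (2 * B t p) • t + B t t • p ∈ symmPart B M u v := by
  have hD : (2 : F) • B.outer t t - B t t • (B.outer v u + B.outer u v) ∈ M := by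
    convert! M.lie_mem ht.2.2 (h.outer_sub_mem_of_mem_symmPart ht) using 1
    ext c
    simp only [lie_apply, outer_apply, LinearMap.add_apply, LinearMap.sub_apply, map_sub, map_add,
      map_smul, LinearMap.smul_apply, h.symm t v, h.symm t u, ht.1, ht.2.1, h.vu, h.uv]
    module
  have h₁ := h.proj_symm_mem_of_mem hD (fun c d ↦ by
    simp only [outer_apply, LinearMap.add_apply, LinearMap.sub_apply, LinearMap.smul_apply,
      map_sub, map_add, map_smul, smul_eq_mul]
    rw [h.symm c t, h.symm c v, h.symm c u]
    ring) h2 hp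
  convert h₁ using 1
  simp only [outer_apply, LinearMap.add_apply, LinearMap.sub_apply, LinearMap.smul_apply,
    map_sub, map_add, map_smul, hp.1, hp.2.1, ht.2.1, h.symm t u, h.uu, h.vv, h.vu,
    proj_eq_self ht.1 ht.2.1, smul_eq_mul, h.proj_left, h.proj_right]
  module

end IsOuterPair

end LinearMap.BilinForm

/-! ### The dichotomy and its two cases. -/

namespace LinearMap.BilinForm.IsOuterPair

variable {F V : Type*} [Field F] [AddCommGroup V] [Module F V] {B : LinearMap.BilinForm F V}
  {M : LieSubalgebra F (Module.End F V)} {v u : V}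

/-- The preimage of the sum under `proj` is stable under the symmetric and the skew part of `M` and
contains `v`, so irreducibility makes it everything. -/
theorem mem_symmPart_sup (h : IsOuterPair B M v u) (h2 : (2 : F) ≠ 0)
    (hM : ∀ X ∈ M, ∃ P ∈ M, ∃ Q ∈ M, X = P + Q ∧ (∀ c d, B (P c) d = B c (P d)) ∧
      ∀ c d, B (Q c) d = -B c (Q d))
    (hirr : ∀ W : Submodule F V, (∀ X ∈ M, ∀ c ∈ W, X c ∈ W) → W = ⊥ ∨ W = ⊤)
    {a : V} (h₁ : B v a = 0) (h₂ : B u a = 0) :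
    a ∈ symmPart B M v u ⊔ symmPart B M u v := by
  set E := symmPart B M v u ⊔ symmPart B M u v with hE
  have le₁ : symmPart B M v u ≤ E := le_sup_left
  have le₂ : symmPart B M u v ≤ E := le_sup_right
  have hvE {X : Module.End F V} (hX : proj B v u (X v) ∈ E) (hX' : proj B v u (X u) ∈ E)
      (hX₁ : ∀ a ∈ symmPart B M v u, proj B v u (X a) ∈ E)
      (hX₂ : ∀ a ∈ symmPart B M u v, proj B v u (X a) ∈ E) :
      ∀ c ∈ E.comap (proj B v u), X c ∈ E.comap (proj B v u) := by
    intro c hc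
    rw [Submodule.mem_comap] at hc ⊢
    rw [eq_proj_add (B := B) v u c]
    obtain ⟨a, ha, b, hb, hab⟩ := Submodule.mem_sup.mp hc
    rw [← hab]
    simp only [map_add, map_smul]
    exact add_mem (add_mem (add_mem (hX₁ a ha) (hX₂ b hb)) (E.smul_mem _ hX)) (E.smul_mem _ hX')
  have htop : E.comap (proj B v u) = ⊤ := by
    refine (hirr _ fun X hX ↦ ?_).resolve_left fun hbot ↦ ?_
    · obtain ⟨P, hP, Q, hQ, rfl, hP', hQ'⟩ := hM X hX
      intro c hc
      rw [LinearMap.add_apply]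
      refine add_mem (hvE ?_ ?_ ?_ ?_ c hc) (hvE ?_ ?_ ?_ ?_ c hc)
      · rw [← proj_swap]; exact le₂ (h.swap.proj_symm_mem hP hP')
      · exact le₁ (h.proj_symm_mem hP hP')
      · intro a ha
        have := add_mem (le₂ (h.proj_symm_mem_of_mem hP hP' h2 ha))
          (E.smul_mem (B v (P u)) (le₁ ha))
        rwa [sub_add_cancel] at this
      · intro a ha
        have := add_mem (le₁ (h.swap.proj_symm_mem_of_mem hP hP' h2 ha))
          (E.smul_mem (B u (P v)) (le₂ ha))
        rwa [sub_add_cancel, proj_swap] at this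
      · exact le₁ (h.proj_skew_mem hQ hQ' h2)
      · rw [← proj_swap]; exact le₂ (h.swap.proj_skew_mem hQ hQ' h2)
      · exact fun a ha ↦ le₁ (h.proj_skew_mem_of_mem hQ hQ' ha)
      · intro a ha
        rw [← proj_swap]; exact le₂ (h.swap.proj_skew_mem_of_mem hQ hQ' ha)
    · have : v ∈ E.comap (proj B v u) := by
        rw [Submodule.mem_comap, h.proj_left]; exact zero_mem _
      rw [hbot, Submodule.mem_bot] at this
      simpa [this] using h.vu
  have := (htop ▸ Submodule.mem_top : a ∈ E.comap (proj B v u))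
  rwa [Submodule.mem_comap, proj_eq_self h₁ h₂] at this

theorem symmPart_le_symmPart (h : IsOuterPair B M v u) (h2 : (2 : F) ≠ 0) (h3 : (3 : F) ≠ 0)
    {t : V} (ht : t ∈ symmPart B M v u) (htt : B t t ≠ 0) :
    t ∈ symmPart B M u v ∧ symmPart B M v u ≤ symmPart B M u v := by
  have h₁ : t ∈ symmPart B M u v := by
    have := h.cubic_mem h2 ht ht
    rw [← add_smul, show 2 * B t t + B t t = 3 * B t t by ring] at this
    exact (Submodule.smul_mem_iff _ (mul_ne_zero h3 htt)).mp this
  refine ⟨h₁, fun p hp ↦ ?_⟩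
  have := sub_mem (h.cubic_mem h2 ht hp) (Submodule.smul_mem _ (2 * B t p) h₁)
  rw [add_sub_cancel_left] at this
  exact (Submodule.smul_mem_iff _ htt).mp this

theorem apply_eq_zero_of_forall_apply_self (h : IsOuterPair B M v u) (h2 : (2 : F) ≠ 0)
    {E : Submodule F V} (hE : ∀ t ∈ E, B t t = 0) {a b : V} (ha : a ∈ E) (hb : b ∈ E) :
    B a b = 0 := by
  have := hE _ (add_mem ha hb)
  simp only [map_add, LinearMap.add_apply, hE a ha, hE b hb, h.symm b a] at this
  have h' : 2 * B a b = 0 := by linear_combination this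
  exact (mul_eq_zero.mp h').resolve_left h2

theorem symmPart_dichotomy (h : IsOuterPair B M v u) (h2 : (2 : F) ≠ 0) (h3 : (3 : F) ≠ 0)
    (hB : ∀ a, (∀ b, B a b = 0) → a = 0)
    (hsup : ∀ a, B v a = 0 → B u a = 0 → a ∈ symmPart B M v u ⊔ symmPart B M u v) :
    (∀ a, B v a = 0 → B u a = 0 → a ∈ symmPart B M v u ∧ a ∈ symmPart B M u v) ∨
    ((∀ a ∈ symmPart B M v u, ∀ b ∈ symmPart B M v u, B a b = 0) ∧
      (∀ a ∈ symmPart B M u v, ∀ b ∈ symmPart B M u v, B a b = 0) ∧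
      symmPart B M v u ≠ ⊥ ∧ symmPart B M u v ≠ ⊥) := by
  have full (hle : symmPart B M v u ≤ symmPart B M u v)
      (hle' : symmPart B M u v ≤ symmPart B M v u) (a : V) (h₁ : B v a = 0) (h₂ : B u a = 0) :
      a ∈ symmPart B M v u ∧ a ∈ symmPart B M u v := by
    have := hsup a h₁ h₂
    exact ⟨(sup_le le_rfl hle') this, (sup_le hle le_rfl) this⟩
  by_cases H₁ : ∃ t ∈ symmPart B M v u, B t t ≠ 0
  · obtain ⟨t, ht, htt⟩ := H₁
    have h₁ := h.symmPart_le_symmPart h2 h3 ht htt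
    exact .inl (full h₁.2 (h.swap.symmPart_le_symmPart h2 h3 h₁.1 htt).2)
  by_cases H₂ : ∃ t ∈ symmPart B M u v, B t t ≠ 0
  · obtain ⟨t, ht, htt⟩ := H₂
    have h₁ := h.swap.symmPart_le_symmPart h2 h3 ht htt
    exact .inl (full (h.symmPart_le_symmPart h2 h3 h₁.1 htt).2 h₁.2)
  push Not at H₁ H₂
  -- If one `symmPart` is zero, the other is the whole complement of the plane; being isotropic
  -- there, it vanishes by nondegeneracy.
  have zero {E : Submodule F V} (hE : ∀ t ∈ E, B t t = 0)
      (hE' : ∀ a, B v a = 0 → B u a = 0 → a ∈ E) (a : V) (h₁ : B v a = 0) (h₂ : B u a = 0) :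
      a = 0 := hB a fun b ↦ by
    rw [h.symm, ← apply_proj b h₁ h₂]
    exact h.apply_eq_zero_of_forall_apply_self h2 hE (hE' _ (h.left_proj b) (h.right_proj b))
      (hE' a h₁ h₂)
  by_cases H₃ : symmPart B M v u = ⊥
  · refine .inl fun a h₁ h₂ ↦ ?_
    rw [H₃, bot_sup_eq] at hsup
    rw [zero H₂ hsup a h₁ h₂]
    exact ⟨zero_mem _, zero_mem _⟩
  by_cases H₄ : symmPart B M u v = ⊥
  · refine .inl fun a h₁ h₂ ↦ ?_
    rw [H₄, sup_bot_eq] at hsup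
    rw [zero H₁ hsup a h₁ h₂]
    exact ⟨zero_mem _, zero_mem _⟩
  exact .inr ⟨fun a ha b hb ↦ h.apply_eq_zero_of_forall_apply_self h2 H₁ ha hb,
    fun a ha b hb ↦ h.apply_eq_zero_of_forall_apply_self h2 H₂ ha hb, H₃, H₄⟩

/-- Sums and differences of `B.outer v s` and `B.outer s v` lie in `M`, hence so does each, and
likewise for `u`; brackets of these give the rest. The correction term makes the trace zero. -/
theorem outer_sub_smul_mem (h : IsOuterPair B M v u) (h2 : (2 : F) ≠ 0)
    (hfull : ∀ a, B v a = 0 → B u a = 0 → a ∈ symmPart B M v u ∧ a ∈ symmPart B M u v)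
    (a b : V) : B.outer a b - B a b • B.outer v u ∈ M := by
  have half {X Y : Module.End F V} (h₁ : X + Y ∈ M) (h₂ : X - Y ∈ M) : X ∈ M ∧ Y ∈ M := by
    constructor
    · refine (Submodule.smul_mem_iff M.toSubmodule h2).mp ?_
      convert! add_mem h₁ h₂ using 1
      module
    · refine (Submodule.smul_mem_iff M.toSubmodule h2).mp ?_
      convert! sub_mem h₁ h₂ using 1
      module
  have key (s : V) (h₁ : B v s = 0) (h₂ : B u s = 0) :
      (B.outer u s ∈ M ∧ B.outer s u ∈ M) ∧ (B.outer v s ∈ M ∧ B.outer s v ∈ M) :=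
    ⟨half (hfull s h₁ h₂).2.2.2 (h.outer_sub_mem_of_mem_symmPart (hfull s h₁ h₂).1),
      half (hfull s h₁ h₂).1.2.2 (h.swap.outer_sub_mem_of_mem_symmPart (hfull s h₁ h₂).2)⟩
  have key' (s t : V) (hs₁ : B v s = 0) (hs₂ : B u s = 0) (ht₁ : B v t = 0) (ht₂ : B u t = 0) :
      B.outer s t - B s t • B.outer v u ∈ M := by
    convert! neg_mem (M.lie_mem (key t ht₁ ht₂).2.1 (key s hs₁ hs₂).1.2) using 1
    ext c
    simp [h.uv, h.symm t s]
    module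
  obtain ⟨⟨h₁, h₂⟩, ⟨h₃, h₄⟩⟩ := key (proj B v u a) (h.left_proj a) (h.right_proj a)
  obtain ⟨⟨h₅, h₆⟩, ⟨h₇, h₈⟩⟩ := key (proj B v u b) (h.left_proj b) (h.right_proj b)
  have h₉ := key' _ _ (h.left_proj a) (h.right_proj a) (h.left_proj b) (h.right_proj b)
  set s := proj B v u a
  set t := proj B v u b
  have : B.outer a b - B a b • B.outer v u = (B.outer s t - B s t • B.outer v u)
      + B u b • B.outer s v + B v b • B.outer s u + B u a • B.outer v t + B v a • B.outer u t
      + (B u a * B u b) • B.outer v v + (B v a * B v b) • B.outer u u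
      - (B v a * B u b) • (B.outer v u - B.outer u v) := by
    rw [eq_proj_add (B := B) v u a, eq_proj_add (B := B) v u b]
    ext c
    simp [h.left_proj, h.right_proj, h.uv, h.vu, h.uu, h.vv, h.symm _ u, h.symm _ v]
    module
  rw [this]
  have sm {r : F} {X : Module.End F V} (hX : X ∈ M) : r • X ∈ M := M.smul_mem r hX
  exact sub_mem (add_mem (add_mem (add_mem (add_mem (add_mem (add_mem h₉ (sm h₄)) (sm h₂)) (sm h₇))
    (sm h₅)) (sm h.mem_v)) (sm h.mem_u)) (sm h.outer_sub_outer_mem)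

theorem eq_top_of_full [FiniteDimensional F V] (h : IsOuterPair B M v u) (h2 : (2 : F) ≠ 0)
    (hB : ∀ a, (∀ b, B a b = 0) → a = 0)
    (hfull : ∀ a, B v a = 0 → B u a = 0 → a ∈ symmPart B M v u ∧ a ∈ symmPart B M u v)
    (htr : ∃ X ∈ M, LinearMap.trace F V X ≠ 0) : M = ⊤ := by
  have h₁ (X : Module.End F V) : X - LinearMap.trace F V X • B.outer v u ∈ M := by
    have hsurj : Function.Surjective B := by
      refine (LinearMap.injective_iff_surjective_of_finrank_eq_finrank
        (Subspace.dual_finrank_eq).symm).mp ?_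
      exact (injective_iff_map_eq_zero B).mpr fun a ha ↦ hB a fun b ↦ by rw [ha]; rfl
    let b := Module.finBasis F V
    have hX : X = ∑ i, (b.coord i).smulRight (X (b i)) := by
      refine b.ext fun j ↦ ?_
      simp [LinearMap.sum_apply, Finsupp.single_apply]
    have hmem (i) : (b.coord i).smulRight (X (b i)) -
        LinearMap.trace F V ((b.coord i).smulRight (X (b i))) • B.outer v u ∈ M := by
      obtain ⟨d, hd⟩ := hsurj (b.coord i)
      rw [LinearMap.trace_smulRight, ← hd, h.symm]
      exact h.outer_sub_smul_mem h2 hfull _ _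
    rw [hX, map_sum, Finset.sum_smul, ← Finset.sum_sub_distrib]
    exact sum_mem fun i _ ↦ hmem i
  obtain ⟨X, hX, hX'⟩ := htr
  have h₂ : B.outer v u ∈ M := by
    have := sub_mem hX (h₁ X)
    rw [sub_sub_cancel] at this
    exact (Submodule.smul_mem_iff M.toSubmodule hX').mp this
  rw [eq_top_iff]
  intro Y _
  have := add_mem (h₁ Y) (M.smul_mem (LinearMap.trace F V Y) h₂)
  rwa [sub_add_cancel] at this

variable (B M v u) in
/-- The sum of the line spanned by `v` and the subspace `symmPart B M v u`. -/
def half : Submodule F V := (symmPart B M v u).comap (proj B v u) ⊓ LinearMap.ker (B v)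

theorem mem_half {c : V} : c ∈ half B M v u ↔ proj B v u c ∈ symmPart B M v u ∧ B v c = 0 :=
  Iff.rfl

theorem skew_apply_mem_half (h : IsOuterPair B M v u) (h2 : (2 : F) ≠ 0)
    (hiso : ∀ a ∈ symmPart B M v u, ∀ b ∈ symmPart B M v u, B a b = 0)
    {Q : Module.End F V} (hQ : Q ∈ M) (hQ' : ∀ c d, B (Q c) d = -B c (Q d)) {c : V}
    (hc : c ∈ half B M v u) : Q c ∈ half B M v u := by
  obtain ⟨h₁, h₂⟩ := hc
  have hc := eq_proj_add (B := B) v u c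
  rw [show B v c = 0 from h₂, zero_smul, add_zero] at hc
  refine mem_half.mpr ⟨?_, ?_⟩
  · rw [hc, map_add, map_add, map_smul, map_smul]
    exact add_mem (h.proj_skew_mem_of_mem hQ hQ' h₁)
      (Submodule.smul_mem _ _ (h.proj_skew_mem hQ hQ' h2))
  · have h₃ : B (Q v) v = 0 := by
      have := hQ' v v
      rw [h.symm v] at this
      have h' : 2 * B (Q v) v = 0 := by linear_combination this
      exact (mul_eq_zero.mp h').resolve_left h2
    -- Isotropy is what keeps `Q c` orthogonal to `v`.
    have h₄ := hiso _ (h.proj_skew_mem hQ hQ' h2) _ h₁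
    rw [apply_proj _ (h.left_proj c) (h.right_proj c)] at h₄
    rw [← neg_eq_zero, ← hQ', hc, map_add, map_smul, h₃, h₄, smul_zero, add_zero]

theorem symm_apply_sub_mem_half (h : IsOuterPair B M v u) (h2 : (2 : F) ≠ 0)
    (hiso : ∀ a ∈ symmPart B M v u, ∀ b ∈ symmPart B M v u, B a b = 0)
    {P : Module.End F V} (hP : P ∈ M) (hP' : ∀ c d, B (P c) d = B c (P d)) {c : V}
    (hc : c ∈ half B M v u) : P c - B v (P u) • c ∈ half B M u v := by
  obtain ⟨h₁, h₂⟩ := hc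
  have hc := eq_proj_add (B := B) v u c
  rw [show B v c = 0 from h₂, zero_smul, add_zero] at hc
  have h₅ : proj B v u (proj B v u c) = proj B v u c := proj_eq_self (h.left_proj c) (h.right_proj c)
  refine mem_half.mpr ⟨?_, ?_⟩
  · rw [proj_swap]
    have := add_mem (h.proj_symm_mem_of_mem hP hP' h2 h₁)
      (Submodule.smul_mem _ (B u c) (h.swap.proj_symm_mem hP hP'))
    convert this using 1
    conv_lhs => rw [hc]
    simp only [map_add, map_sub, map_smul, h₅, h.proj_left, proj_swap]
    module
  · have h₄ := hiso _ (h.proj_symm_mem hP hP') _ h₁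
    rw [apply_proj _ (h.left_proj c) (h.right_proj c)] at h₄
    rw [map_sub, map_smul, ← hP']
    have h₆ : B (P u) c = B u c * B v (P u) := by
      conv_lhs => rw [hc]
      rw [map_add, map_smul, h₄, h.symm (P u) v, smul_eq_mul, zero_add]
    rw [h₆, smul_eq_mul]
    ring

theorem half_inf_half (h : IsOuterPair B M v u) (hB : ∀ a, (∀ b, B a b = 0) → a = 0)
    (hsup : ∀ a, B v a = 0 → B u a = 0 → a ∈ symmPart B M v u ⊔ symmPart B M u v)
    (hiso : ∀ a ∈ symmPart B M v u, ∀ b ∈ symmPart B M v u, B a b = 0)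
    (hiso' : ∀ a ∈ symmPart B M u v, ∀ b ∈ symmPart B M u v, B a b = 0)
    {c : V} (hc : c ∈ half B M v u) (hc' : c ∈ half B M u v) : c = 0 := by
  rw [mem_half] at hc hc'
  have h₁ := proj_eq_self hc.2 hc'.2
  rw [proj_swap, h₁] at hc'
  rw [h₁] at hc
  refine hB c fun b ↦ ?_
  rw [h.symm, ← apply_proj b hc.2 hc'.2]
  obtain ⟨a, ha, d, hd, had⟩ := Submodule.mem_sup.mp (hsup _ (h.left_proj b) (h.right_proj b))
  rw [← had, map_add, LinearMap.add_apply, hiso a ha c hc.1, hiso' d hd c hc'.1, add_zero]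

theorem half_sup_half (h : IsOuterPair B M v u)
    (hsup : ∀ a, B v a = 0 → B u a = 0 → a ∈ symmPart B M v u ⊔ symmPart B M u v) (c : V) :
    ∃ a ∈ half B M v u, ∃ b ∈ half B M u v, a + b = c := by
  obtain ⟨a, ha, d, hd, had⟩ := Submodule.mem_sup.mp (hsup _ (h.left_proj c) (h.right_proj c))
  refine ⟨a + B u c • v, mem_half.mpr ⟨?_, ?_⟩, d + B v c • u, mem_half.mpr ⟨?_, ?_⟩, ?_⟩
  · rwa [map_add, map_smul, h.proj_left, smul_zero, add_zero, proj_eq_self ha.1 ha.2.1]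
  · rw [map_add, map_smul, ha.1, h.vv, smul_zero, add_zero]
  · rwa [map_add, map_smul, h.swap.proj_left, smul_zero, add_zero, proj_eq_self hd.1 hd.2.1]
  · rw [map_add, map_smul, hd.1, h.uu, smul_zero, add_zero]
  · rw [eq_proj_add (B := B) v u c, ← had]
    simp [ha.1, ha.2.1, hd.1, hd.2.1, h.vv, h.uu, h.vu, h.uv]
    module

theorem exists_mem_half_notMem_span (h : IsOuterPair B M v u) (hne : symmPart B M v u ≠ ⊥)
    (a : V) : ∃ c ∈ half B M v u, c ∉ Submodule.span F {a} := by
  obtain ⟨t, ht, ht₀⟩ := Submodule.exists_mem_ne_zero_of_ne_bot hne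
  by_contra! H
  obtain ⟨r, hr⟩ := Submodule.mem_span_singleton.mp <| H v
    (mem_half.mpr ⟨by rw [h.proj_left]; exact zero_mem _, h.vv⟩)
  obtain ⟨s, hs⟩ := Submodule.mem_span_singleton.mp <| H t
    (mem_half.mpr ⟨by rwa [proj_eq_self ht.1 ht.2.1], ht.1⟩)
  have h₁ : r * B u a = 1 := by rw [← smul_eq_mul, ← map_smul, hr, h.uv]
  have h₂ : s * B u a = 0 := by rw [← smul_eq_mul, ← map_smul, hs, ht.2.1]
  have h₃ : s = 0 := (mul_eq_zero.mp h₂).resolve_right fun h ↦ by simp [h] at h₁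
  exact ht₀ (by rw [← hs, h₃, zero_smul])

end LinearMap.BilinForm.IsOuterPair

/-- The vector `u` is `y v`, corrected by a multiple of `v` to be isotropic and then normalised. The
bracket of `B.outer v v` with `y` is a multiple of `z = B.outer v u - B.outer u v`, whose adjoint
action is a grading that isolates `B.outer u u` inside `y`. -/
theorem LinearMap.BilinForm.IsOuterPair.exists_of_apply_ne_zero {F V : Type*} [Field F] [CharZero F]
    [AddCommGroup V] [Module F V] {B : LinearMap.BilinForm F V}
    {M : LieSubalgebra F (Module.End F V)} (hB : ∀ a b, B a b = B b a) {v : V} (hv : B v v = 0)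
    (hvM : B.outer v v ∈ M) {y : Module.End F V} (hy : y ∈ M)
    (hy' : ∀ c d, B (y c) d = B c (y d)) (hyv : B (y v) v ≠ 0) :
    ∃ u, IsOuterPair B M v u := by
  obtain ⟨β, hβ, μ, u, hvu, huu, hyu⟩ : ∃ β : F, β ≠ 0 ∧ ∃ (μ : F) (u : V),
      B v u = 1 ∧ B u u = 0 ∧ y v = β • u + μ • v := by
    set β := B (y v) v
    have h₁ : B v (y v) = β := hB _ _
    refine ⟨β, hyv, B (y v) (y v) / (2 * β), β⁻¹ • y v - (B (y v) (y v) / (2 * β ^ 2)) • v,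
      ?_, ?_, ?_⟩
    · simp [h₁, hv, hyv]
    · simp only [map_sub, map_smul, LinearMap.sub_apply, LinearMap.smul_apply, smul_eq_mul, hv, h₁,
        show B (y v) v = β from rfl]
      field_simp
      ring
    · rw [smul_sub, smul_smul, smul_smul, mul_inv_cancel₀ hyv, one_smul,
        show β * (B (y v) (y v) / (2 * β ^ 2)) = B (y v) (y v) / (2 * β) by field_simp]
      abel
  have huv : B u v = 1 := by rw [hB, hvu]
  have hz : B.outer v u - B.outer u v ∈ M := by
    refine (Submodule.smul_mem_iff M.toSubmodule hβ).mp ?_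
    convert! M.lie_mem hvM hy using 1
    ext c
    have := hy' v c
    simp only [lie_apply, outer_apply, LinearMap.sub_apply, LinearMap.smul_apply, map_smul,
      ← this, hyu, map_add, LinearMap.add_apply, smul_eq_mul]
    module
  obtain ⟨r, δ, hvr, hur, hr⟩ : ∃ (r : V) (δ : F), B v r = 0 ∧ B u r = 0 ∧
      y u = r + μ • u + δ • v := by
    have h₁ : B v (y u) = μ := by rw [← hy', hyu]; simp [huu, hvu]
    refine ⟨y u - μ • u - B u (y u) • v, B u (y u), ?_, ?_, by abel⟩
    · simp [h₁, hvu, hv]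
    · simp [huu, huv]
  set z := B.outer v u - B.outer u v
  have h₁ : B.outer v r + B.outer r v - (2 * β) • B.outer u u ∈ M := by
    convert! sub_mem (M.lie_mem hz hy) (M.smul_mem (2 * δ) hvM) using 1
    ext c
    have e₁ := hy' v c
    have e₂ := hy' u c
    simp only [z, lie_apply, outer_apply, LinearMap.sub_apply, LinearMap.add_apply,
      LinearMap.smul_apply, map_smul, map_sub, ← e₁, ← e₂, hyu, hr, map_add, smul_eq_mul]
    module
  -- `ad z` has eigenvalue `1` on `B.outer v r + B.outer r v` and `-2` on `B.outer u u`, so `ad z -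
  -- 1` leaves only the latter.
  have h₂ : (6 * β) • B.outer u u ∈ M := by
    convert! sub_mem (M.lie_mem hz h₁) h₁ using 1
    ext c
    simp only [z, lie_apply, outer_apply, LinearMap.sub_apply, LinearMap.add_apply,
      LinearMap.smul_apply, map_smul, map_sub, map_add, hvr, hur, hB r u, hB r v,
      hv, huu, huv, hvu]
    module
  exact ⟨u, hB, hv, huu, hvu, hvM,
    (Submodule.smul_mem_iff M.toSubmodule (mul_ne_zero (by norm_num) hβ)).mp h₂⟩

/-! ### Vanishing of the product in the isotropic case. -/

namespace LieTripleSystem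

variable {F T : Type*} [Field F] [CharZero F] [AddCommGroup T] [Module F T]
  (S : LieTripleSystem F T)

theorem product_eq_zero_of_isotropic {E E' : Submodule F T}
    (hE : ∀ a b, ∀ c ∈ E, S.product a b c ∈ E) (hE' : ∀ a b, ∀ c ∈ E', S.product a b c ∈ E')
    (hsymm : ∀ a b, ∃ r : F, ∀ c ∈ E, S.R a b c + S.R b a c - r • c ∈ E')
    (hinf : ∀ c ∈ E, c ∈ E' → c = 0) (hdim : ∀ a, ∃ c ∈ E, c ∉ Submodule.span F {a})
    {a c : T} (ha : a ∈ E) (hc : c ∈ E) :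
    (∀ b ∈ E, S.product a b c = 0) ∧ ∀ b ∈ E', S.product a b c = 0 ∧ S.product a c b = 0 := by
  simp only [R_apply] at hsymm
  constructor
  · have h₁ {a c : T} (ha : a ∈ E) (hc : c ∈ E) : S.product c a a = 0 := by
      obtain ⟨r, hr⟩ := hsymm a a
      have h₂ {c : T} (hc : c ∈ E) : S.product c a a + S.product c a a - r • c = 0 :=
        hinf _ (sub_mem (add_mem (hE _ _ _ ha) (hE _ _ _ ha)) (E.smul_mem r hc)) (hr c hc)
      have h₃ := h₂ ha
      rw [S.product_self, add_zero, zero_sub, neg_eq_zero, smul_eq_zero] at h₃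
      obtain h₃ | h₃ := h₃
      · have := h₂ hc
        rw [h₃, zero_smul, sub_zero, ← two_smul F] at this
        exact (smul_eq_zero.mp this).resolve_left two_ne_zero
      · simp [h₃]
    have h₂ {a b c : T} (ha : a ∈ E) (hb : b ∈ E) (hc : c ∈ E) :
        S.product c a b + S.product c b a = 0 := by
      have := h₁ (add_mem ha hb) hc
      simpa [h₁ ha hc, h₁ hb hc, add_comm] using this
    intro b hb
    have h₃ := S.product_eq_sub a b c
    have h₄ := h₂ ha hb hc
    have h₅ := h₂ hb hc ha
    have h₆ := S.product_skew a c b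
    -- On `E` the product is now skew in its last two arguments as well as its first two, so the
    -- Jacobi identity reads `3 [a, b, c] = 0`.
    have h₇ : (3 : F) • S.product a b c = 0 := by
      linear_combination (norm := module) h₃ + h₄ + (2 : F) • h₅ - (2 : F) • h₆
    exact (smul_eq_zero.mp h₇).resolve_left three_ne_zero
  · intro b hb
    have h₁ {a : T} (ha : a ∈ E) : ∃ r : F, ∀ c ∈ E, S.product c b a = r • c := by
      obtain ⟨r, hr⟩ := hsymm a b
      refine ⟨r, fun c hc ↦ sub_eq_zero.mp <|
        hinf _ (sub_mem (hE _ _ _ ha) (E.smul_mem r hc)) ?_⟩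
      have := sub_mem (hr c hc) (hE' c a b hb)
      rwa [add_sub_assoc, add_sub_cancel_left] at this
    have h₂ {a c : T} (ha : a ∈ E) (hc : c ∈ E) : S.product a c b = 0 := by
      refine hinf _ ?_ (hE' _ _ _ hb)
      rw [S.product_eq_sub, S.product_skew b c, S.product_skew b a]
      exact sub_mem (neg_mem (hE _ _ _ ha)) (neg_mem (hE _ _ _ hc))
    have h₃ {a c : T} (ha : a ∈ E) (hc : c ∈ E) : S.product c b a = S.product a b c := by
      have := S.product_eq_sub a c b
      rw [h₂ ha hc, S.product_skew b c, S.product_skew b a] at this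
      linear_combination (norm := module) this
    refine ⟨?_, h₂ ha hc⟩
    obtain ⟨r, hr⟩ := h₁ hc
    -- By `h₃`, the scalars attached to two vectors of `E` satisfy `r_a c = r_c a`; they vanish
    -- because `E` is not contained in a line.
    suffices r = 0 by rw [hr a ha, this, zero_smul]
    by_contra hr₀
    obtain ⟨d, hd, hd'⟩ := hdim c
    obtain ⟨s, hs⟩ := h₁ hd
    refine hd' (Submodule.mem_span_singleton.mpr ⟨r⁻¹ * s, ?_⟩)
    rw [mul_smul, ← hs c hc, h₃ hd hc, hr d hd, smul_smul, inv_mul_cancel₀ hr₀, one_smul]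

end LieTripleSystem

/-! ### Conclusion. -/

theorem theorem2 {F : Type*} [Field F] [IsAlgClosed F] [CharZero F]
    {T : Type*} [AddCommGroup T] [Module F T] [FiniteDimensional F T]
    (S : LieTripleSystem F T) (hS : S.IsSimple) :
    LieSubalgebra.lieSpan F (Module.End F T) {f | ∃ a b : T, f = S.R a b} = ⊤ := by
  set M := LieSubalgebra.lieSpan F (Module.End F T) {f | ∃ a b : T, f = S.R a b}
  have hR (a b : T) : S.R a b ∈ M := LieSubalgebra.subset_lieSpan ⟨a, b, rfl⟩
  have hproduct (a b : T) : S.product a b ∈ M := by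
    rw [S.product_eq_R_sub]; exact sub_mem (hR b a) (hR a b)
  have hproduct' (a b c d : T) : S.form (S.product a b c) d = -S.form c (S.product a b d) :=
    S.form_innerDer (S.inner a b) c d
  have hRsymm (a b c d : T) :
      S.form ((S.R a b + S.R b a) c) d = S.form c ((S.R a b + S.R b a) d) := by
    simp [S.form_R, add_comm]
  have htranspose : ∀ X ∈ M, ∃ Y ∈ M, ∀ c d, S.form (X c) d = S.form c (Y d) := by
    intro X hX
    induction hX using LieSubalgebra.lieSpan_induction with
    | mem X hX =>
      obtain ⟨a, b, rfl⟩ := hX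
      exact ⟨S.R b a, hR b a, S.form_R a b⟩
    | zero => exact ⟨0, zero_mem _, by simp⟩
    | add X X' _ _ h h' =>
      obtain ⟨Y, hY, e⟩ := h
      obtain ⟨Y', hY', e'⟩ := h'
      exact ⟨Y + Y', add_mem hY hY', fun c d ↦ by simp [e, e']⟩
    | smul r X _ h =>
      obtain ⟨Y, hY, e⟩ := h
      exact ⟨r • Y, M.smul_mem r hY, fun c d ↦ by simp [e]⟩
    | lie X X' _ _ h h' =>
      obtain ⟨Y, hY, e⟩ := h
      obtain ⟨Y', hY', e'⟩ := h'
      exact ⟨⁅Y', Y⁆, M.lie_mem hY' hY, fun c d ↦ by simp [e, e']⟩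
  have hdecomp : ∀ X ∈ M, ∃ P ∈ M, ∃ Q ∈ M, X = P + Q ∧
      (∀ c d, S.form (P c) d = S.form c (P d)) ∧ ∀ c d, S.form (Q c) d = -S.form c (Q d) := by
    intro X hX
    obtain ⟨Y, hY, e⟩ := htranspose X hX
    have e' (c d : T) : S.form (Y c) d = S.form c (X d) := by
      rw [S.form_comm, ← e, S.form_comm]
    refine ⟨(2⁻¹ : F) • (X + Y), M.smul_mem _ (add_mem hX hY),
      (2⁻¹ : F) • (X - Y), M.smul_mem _ (sub_mem hX hY), by module, fun c d ↦ ?_, fun c d ↦ ?_⟩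
    · simp [e, e', add_comm]
    · simp [e, e']; ring
  have hirr (W : Submodule F T) (hW : ∀ X ∈ M, ∀ c ∈ W, X c ∈ W) : W = ⊥ ∨ W = ⊤ :=
    hS.2 W fun x hx a b ↦ hW _ (hR a b) x hx
  obtain ⟨v, k, hv, hk, hRv⟩ := hS.exists_R_self_eq
  obtain ⟨w, hw⟩ : ∃ w, S.form v w ≠ 0 := by
    by_contra! H; exact hv (hS.form_nondegenerate v H)
  have hvv : S.form v v = 0 := by
    have := hRv v
    rw [S.R_apply, S.product_self, eq_comm, smul_eq_zero] at this
    simpa [hk, hv] using this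
  have hvM : S.form.outer v v ∈ M := by
    refine (Submodule.smul_mem_iff M.toSubmodule hk).mp ?_
    convert! hR v v using 1
    ext c
    simp [hRv, mul_smul]
  -- The value is `k * (S.form v w) ^ 2`, by skewness of inner derivations.
  have hwv : S.form (S.R w w v) v ≠ 0 := by
    rw [S.R_apply, hproduct', S.product_skew, ← S.R_apply, hRv, map_neg, neg_neg, map_smul,
      S.form_comm w v]
    simp [hk, hw]
  obtain ⟨u, h⟩ := LinearMap.BilinForm.IsOuterPair.exists_of_apply_ne_zero S.form_comm hvv hvM
    (hR w w) (S.form_R w w) hwv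
  have h2 : (2 : F) ≠ 0 := two_ne_zero
  have hsup (a : T) (h₁ : S.form v a = 0) (h₂ : S.form u a = 0) :=
    h.mem_symmPart_sup h2 hdecomp hirr h₁ h₂
  obtain hfull | ⟨h₁, h₂, h₃, h₄⟩ :=
    h.symmPart_dichotomy h2 three_ne_zero hS.form_nondegenerate hsup
  · refine h.eq_top_of_full h2 hS.form_nondegenerate hfull ?_
    -- If `M` were traceless, `form_eq_trace` would make the form zero.
    by_contra! H
    refine hw ?_
    rw [S.form_eq_trace, H _ (hR _ _), H _ (hR _ _), add_zero]
  · exfalso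
    have hinf {c : T} := h.half_inf_half hS.form_nondegenerate hsup h₁ h₂ (c := c)
    have hE (a b c : T) := h.skew_apply_mem_half h2 h₁ (hproduct a b) (hproduct' a b) (c := c)
    have hE' (a b c : T) :=
      h.swap.skew_apply_mem_half h2 h₂ (hproduct a b) (hproduct' a b) (c := c)
    have key {a c : T} := S.product_eq_zero_of_isotropic hE hE'
      (fun a b ↦ ⟨_, fun c ↦ h.symm_apply_sub_mem_half h2 h₁
        (add_mem (hR a b) (hR b a)) (hRsymm a b)⟩) (fun c ↦ hinf)
      (h.exists_mem_half_notMem_span h₃) (a := a) (c := c)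
    have key' {a c : T} := S.product_eq_zero_of_isotropic hE' hE
      (fun a b ↦ ⟨_, fun c ↦ h.swap.symm_apply_sub_mem_half h2 h₂
        (add_mem (hR a b) (hR b a)) (hRsymm a b)⟩) (fun c h h' ↦ hinf h' h)
      (h.swap.exists_mem_half_notMem_span h₄) (a := a) (c := c)
    obtain ⟨x, y, z, hxyz⟩ := hS.1
    refine hxyz ?_
    obtain ⟨a, ha, a', ha', rfl⟩ := h.half_sup_half hsup x
    obtain ⟨b, hb, b', hb', rfl⟩ := h.half_sup_half hsup y
    obtain ⟨c, hc, c', hc', rfl⟩ := h.half_sup_half hsup z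
    -- Each of the eight terms has its arguments in the two halves and vanishes by `key` or `key'`,
    -- up to swapping the first two arguments.
    simp only [map_add, LinearMap.add_apply]
    rw [(key ha hc).1 b hb, ((key ha hb).2 c' hc').2, ((key ha hc).2 b' hb').1,
      S.product_skew a b' c', ((key' hb' hc').2 a ha).1, S.product_skew a' b c,
      ((key hb hc).2 a' ha').1, ((key' ha' hc').2 b hb).1, ((key' ha' hb').2 c hc).2,
      (key' ha' hc').1 b' hb']
    simp
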